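/- Let $N\ge 1$ and $K\ge 1$. There are $N$ non-communicating databases, each storing the same $K$ independent messages $W_1,\dots,W_K$ of $L$ bits each, $H(W_i)=L$. For a caching ratio $r\in[0,1]$, a user stores, before it knows which message it will want, the values $Z$ of $Lr$ bits (rounded down if $Lr$ is not an integer) of every message, at positions $\mathbb H$ that are random and independent of the messages (with an arbitrary joint law, for instance uniform and independent over the messages). To retrieve $W_k$, the user sends queries $Q_1^{[k]},\dots,Q_N^{[k]}$ such that $(\mathbb H,Q_{1}^{[k]},\dots,Q_N^{[k]})$ is independent of $(W_1,\dots,W_K)$; database $n$ replies with $A_n^{[k]}$, a function of $Q_n^{[k]}$ and $W_1,\dots,W_K$. Queries and answers take finitely many values. Privacy: for every $n$ the law of $(Q_n^{[k]},A_n^{[k]},W_1,\dots,W_K)$ does not depend on $k$. The download cost is $D=\sum_{n=1}^N H(A_n^{[k]})$, which by privacy does not depend on $k$. A number $d$ is an achievable normalized download cost at caching ratio $r$ if there are such schemes with message lengths $L\to\infty$, with $H(W_k\mid Z,\mathbb H,Q_{1:N}^{[k]},A_{1:N}^{[k]})=o(L)$ for every $k$, and with $D/L\to d$. Let $D^*(r)$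 be the infimum of the achievable $d$. **Theorem 2 (inner bound).** For every $r\in[0,1]$, $$D^*(r)\ \ge\ \tilde D(r)=\max_{i\in\{2,\dots,K+1\}} f_i(r),\qquad f_i(r)=(1-r)\sum_{j=0}^{K+1-i}\frac1{N^j}-r\sum_{j=0}^{K-i}\frac{K+1-i-j}{N^j},$$ where the last sum is empty for $i=K+1$. The bound $\tilde D$ is piecewise linear on $[0,1]$ with $K$ segments: with $\tilde r_0=0$ and $\tilde r_s=\frac1{1+N+\cdots+N^{K-s}}$ for $1\le s\le K$ one has $0=\tilde r_0<\tilde r_1<\cdots<\tilde r_K=1$, $\tilde D=f_{s+2}$ on $[\tilde r_s,\tilde r_{s+1}]$ for $0\le s<K$, and the slope of $f_{s+2}$ is strictly smaller than that of $f_{s+3}$ for $0\le s<K-1$. -/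

import Mathlib

open MeasureTheory ProbabilityTheory Filter Topology

noncomputable section

namespace CachePIR

/-- Shannon entropy, in bits, of a random variable with finitely many values. -/
def entropy {Ω α : Type*} [MeasurableSpace Ω] [Fintype α] (P : Measure Ω) (X : Ω → α) : ℝ :=
  -∑ x, P.real {ω | X ω = x} * Real.logb 2 (P.real {ω | X ω = x})

/-- Conditional Shannon entropy `H(X | Y)`, in bits, of random variables with finitely many
values: `∑ P(X = x, Y = y) log₂ (P(Y = y) / P(X = x, Y = y))`, where terms with
`P(X = x, Y = y) = 0` vanish. -/
def condEntropy {Ω α β : Type*} [MeasurableSpace Ω] [Fintype α] [Fintype β] (P : Measure Ω)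
    (X : Ω → α) (Y : Ω → β) : ℝ :=
  ∑ x, ∑ y, P.real {ω | X ω = x ∧ Y ω = y} *
    Real.logb 2 (P.real {ω | Y ω = y} / P.real {ω | X ω = x ∧ Y ω = y})

/-- A private information retrieval scheme with uncoded prefetching that the databases do not
know: `N` databases, `K` messages of `L` bits each, and `c` cached bits of every message.
The reliability of the decoding is a separate, asymptotic requirement. -/
structure Scheme (N K L c : ℕ) where
  /-- the underlying probability space -/
  Ω : Type
  [measΩ : MeasurableSpace Ω]
  P : Measure Ω
  [probP : IsProbabilityMeasure P]
  /-- `W i` is the message number `i` -/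
  W : Fin K → Ω → (Fin L → Bool)
  /-- `idx ω i` lists, in increasing order, the positions of the `c` cached bits of
  message `i` -/
  idx : Ω → Fin K → Fin c → Fin L
  /-- the sizes of the finite query and answer alphabets -/
  q : ℕ
  a : ℕ
  /-- `Q k n` is the query to database `n` when message `k` is desired -/
  Q : Fin K → Fin N → Ω → Fin q
  /-- `A k n` is the answer of database `n` when message `k` is desired -/
  A : Fin K → Fin N → Ω → Fin a
  measurable_W : ∀ i, Measurable (W i)
  measurable_idx : Measurable idx
  measurable_Q : ∀ k n, Measurable (Q k n)
  measurable_A : ∀ k n, Measurable (A k n)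
  /-- the messages are independent -/
  indep_W : iIndepFun W P
  /-- every message has `L` bits of entropy -/
  entropy_W : ∀ i, entropy P (W i) = L
  strictMono_idx : ∀ ω i, StrictMono (idx ω i)
  /-- the cached positions and the queries are chosen independently of the messages -/
  indep_query : ∀ k,
    IndepFun (fun ω => (idx ω, fun n => Q k n ω)) (fun ω i => W i ω) P
  /-- privacy: the view of a single database does not depend on the desired message -/
  privacy : ∀ n k k',
    IdentDistrib (fun ω => (Q k n ω, A k n ω, fun i => W i ω))
      (fun ω => (Q k' n ω, A k' n ω, fun i => W i ω)) P P
  /-- an answer is a function of the query and the messages -/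
  answer : ∀ k n, condEntropy P (A k n) (fun ω => (Q k n ω, fun i => W i ω)) = 0

attribute [instance] Scheme.measΩ Scheme.probP

namespace Scheme

variable {N K L c : ℕ} (S : Scheme N K L c)

/-- The cache content: the values of the cached bits of every message. -/
def Z (ω : S.Ω) : Fin K → Fin c → Bool := fun i j => S.W i ω (S.idx ω i j)

/-- The uncertainty about the desired message `k` that is left to the user, who knows the cache
content, the cached positions, the queries and the answers. -/
def equivocation (k : Fin K) : ℝ :=
  condEntropy S.P (S.W k)
    (fun ω => (S.Z ω, S.idx ω, (fun n => S.Q k n ω), (fun n => S.A k n ω)))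

/-- The expected number of downloaded bits when message `k` is desired. -/
def downloadCost (k : Fin K) : ℝ := ∑ n, entropy S.P (S.A k n)

end Scheme

/-- `d` is an achievable normalized download cost at caching ratio `r`: there are schemes with
message lengths `L m → ∞` that cache `r * L m` bits (rounded down) of each message,
whose equivocation is `o(L m)` for each desired message, and whose download cost per message bit
tends to `d`. -/
def Achievable (N K : ℕ) (r d : ℝ) : Prop :=
  ∃ (L : ℕ → ℕ) (S : ∀ m, Scheme N K (L m) ⌊r * (L m : ℝ)⌋₊),
    Tendsto L atTop atTop ∧
    (∀ k, Tendsto (fun m => (S m).equivocation k / (L m : ℝ)) atTop (𝓝 0)) ∧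
    (∀ k, Tendsto (fun m => (S m).downloadCost k / (L m : ℝ)) atTop (𝓝 d))

/-- The optimal normalized download cost `D*(r)`: the infimum of the achievable ones, taken in
the extended reals. -/
def optimalCost (N K : ℕ) (r : ℝ) : EReal :=
  sInf {x : EReal | ∃ d : ℝ, Achievable N K r d ∧ x = (d : EReal)}

/-- The affine function of `r` that belongs to the index `i`, for `2 ≤ i ≤ K + 1`:
`(1 - r) ∑_{j=0}^{K+1-i} 1/N^j - r ∑_{j=0}^{K-i} (K+1-i-j)/N^j`;
the second sum is empty for `i = K + 1`. -/
def innerLine (N K i : ℕ) (r : ℝ) : ℝ :=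
  (1 - r) * ∑ j ∈ Finset.range (K + 2 - i), 1 / (N : ℝ) ^ j
    - r * ∑ j ∈ Finset.range (K + 1 - i), ((K : ℝ) + 1 - i - j) / (N : ℝ) ^ j

/-- The inner bound, the maximum of these functions over `i ∈ {2, …, K + 1}`. -/
def innerBound (N K : ℕ) (hK : 1 ≤ K) (r : ℝ) : ℝ :=
  (Finset.Icc 2 (K + 1)).sup' (Finset.nonempty_Icc.2 (Nat.succ_le_succ hK))
    (fun i => innerLine N K i r)

/-- The end points of the segments: `0` for `s = 0`, and `1 / (1 + N + ⋯ + N^(K-s))` for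
`1 ≤ s ≤ K`. -/
def corner (N K s : ℕ) : ℝ :=
  if s = 0 then 0 else 1 / ∑ j ∈ Finset.range (K - s + 1), (N : ℝ) ^ j

end CachePIR

end

/-! Suppose the desired message `k` and `m` others are unknown to the user. Decoding message `k`
removes at least `(1 - r) L` bits from the entropy of the answers given the user's knowledge. What
remains is at least the `N`-th part of the corresponding entropy for another desired message: by
privacy and independence each database's answer, given only its own query, has the same entropy for
both, and the cache can hide at most `r L` bits of each unknown message. Writing `L f m` for the
resulting bound, this gives `f 0 = 1 - r` and `f (m + 1) = (1 - r) + f m / N - r (m + 1)`, whose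
solutions are the lines of the inner bound. The increment `f (m + 1) - f m` changes sign at
`r = 1 / (1 + N + ⋯ + N ^ (m + 1))`, which decreases with `m`, so exactly one line is on top on each
segment. -/

noncomputable section

namespace CachePIR

section Entropy

variable {Ω α β γ : Type*} [MeasurableSpace Ω] {P : Measure Ω} {X : Ω → α} {Y : Ω → β}
  {Z : Ω → γ}

theorem sum_mul_logb_le_sum_mul_logb {ι : Type*} {s : Finset ι} {p q : ι → ℝ}
    (hp : ∀ i ∈ s, 0 ≤ p i) (hq : ∀ i ∈ s, 0 ≤ q i) (hpq : ∀ i ∈ s, q i = 0 → p i = 0)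
    (h : ∑ i ∈ s, q i ≤ ∑ i ∈ s, p i) :
    ∑ i ∈ s, p i * Real.logb 2 (q i) ≤ ∑ i ∈ s, p i * Real.logb 2 (p i) := by
  have log_two_pos : 0 < Real.log 2 := Real.log_pos one_lt_two
  have pointwise : ∀ i ∈ s, p i * Real.log (q i) - p i * Real.log (p i) ≤ q i - p i := by
    intro i hi
    rcases (hp i hi).eq_or_lt with hpi | hpi
    · simpa [← hpi] using hq i hi
    · have hqi : 0 < q i := (hq i hi).lt_of_ne fun h0 => hpi.ne' (hpq i hi h0.symm)
      calc p i * Real.log (q i) - p i * Real.log (p i) = p i * Real.log (q i / p i) := by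
            rw [Real.log_div hqi.ne' hpi.ne', mul_sub]
        _ ≤ p i * (q i / p i - 1) := by
            gcongr
            exact Real.log_le_sub_one_of_pos (div_pos hqi hpi)
        _ = q i - p i := by field_simp
  have summed := Finset.sum_le_sum pointwise
  simp only [Finset.sum_sub_distrib] at summed
  simp only [Real.logb, ← mul_div_assoc, ← Finset.sum_div]
  exact div_le_div_of_nonneg_right (by linarith) log_two_pos.le

theorem measureReal_le_measureReal_comp [IsFiniteMeasure P] (f : α → β) (a : α) :
    P.real {ω | X ω = a} ≤ P.real {ω | f (X ω) = f a} :=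
  measureReal_mono fun _ h => congrArg f h

theorem entropy_const [Fintype α] [IsProbabilityMeasure P] (a : α) :
    entropy P (fun _ : Ω => a) = 0 := by
  refine neg_eq_zero.2 (Finset.sum_eq_zero fun x _ => ?_)
  by_cases h : a = x <;> simp [h]

variable [Fintype α] [MeasurableSpace α] [MeasurableSingletonClass α]

theorem entropy_eq_of_identDistrib {Ω' : Type*} [MeasurableSpace Ω'] {P' : Measure Ω'}
    {X' : Ω' → α} (h : IdentDistrib X X' P P') : entropy P X = entropy P' X' := by
  have real_eq (x : α) : P.real {ω | X ω = x} = P'.real {ω | X' ω = x} :=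
    congrArg ENNReal.toReal (h.measure_mem_eq (measurableSet_singleton x))
  simp only [entropy, real_eq]

theorem measureReal_comp_eq_sum [IsFiniteMeasure P] [DecidableEq β] (hX : Measurable X)
    (f : α → β) (b : β) :
    P.real {ω | f (X ω) = b} = ∑ a with f a = b, P.real {ω | X ω = a} := by
  refine Eq.trans ?_ (sum_measureReal_preimage_singleton {a | f a = b}
    fun a _ => hX (measurableSet_singleton a)).symm
  congr 1
  ext ω
  simp

theorem sum_measureReal_eq_one [IsProbabilityMeasure P] (hX : Measurable X) :
    ∑ a, P.real {ω | X ω = a} = 1 := by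
  simpa using (measureReal_comp_eq_sum (P := P) hX (fun _ => ()) ()).symm

theorem sum_measureReal_prodMk [IsFiniteMeasure P] (hX : Measurable X) (y : β) :
    ∑ x, P.real {ω | (X ω, Y ω) = (x, y)} = P.real {ω | Y ω = y} := by
  have fibers := sum_measureReal_preimage_singleton (μ := P.restrict (Y ⁻¹' {y})) Finset.univ
    fun x _ => hX (measurableSet_singleton x)
  simp only [Finset.coe_univ, Set.preimage_univ, measureReal_restrict_apply_univ] at fibers
  refine Eq.trans (Finset.sum_congr rfl fun x _ => ?_) fibers
  rw [measureReal_restrict_apply (hX (measurableSet_singleton x))]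
  congr 1
  ext ω
  simp

variable [Fintype β]

theorem entropy_comp [IsFiniteMeasure P] (hX : Measurable X) (f : α → β) :
    entropy P (fun ω => f (X ω)) =
      -∑ a, P.real {ω | X ω = a} * Real.logb 2 (P.real {ω | f (X ω) = f a}) := by
  classical
  rw [entropy, ← Finset.sum_fiberwise_of_maps_to (g := f) fun a _ => Finset.mem_univ (f a)]
  congr! 2 with b
  nth_rw 1 [measureReal_comp_eq_sum hX f b]
  rw [Finset.sum_mul]
  exact Finset.sum_congr rfl fun a ha => by rw [(Finset.mem_filter.1 ha).2]

theorem entropy_comp_le [IsFiniteMeasure P] (hX : Measurable X) (f : α → β) :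
    entropy P (fun ω => f (X ω)) ≤ entropy P X := by
  rw [entropy_comp hX, entropy]
  refine neg_le_neg (Finset.sum_le_sum fun a _ => ?_)
  rcases (measureReal_nonneg (μ := P) (s := {ω | X ω = a})).eq_or_lt with h | h
  · simp [← h]
  · exact mul_le_mul_of_nonneg_left
      (Real.logb_le_logb_of_le one_lt_two h (measureReal_le_measureReal_comp f a)) h.le

theorem entropy_le_of_factorsThrough [IsProbabilityMeasure P] (hX : Measurable X)
    (h : Y.FactorsThrough X) :
    entropy P Y ≤ entropy P X := by
  have : Nonempty β := (nonempty_of_isProbabilityMeasure P).map Y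
  obtain ⟨f, rfl⟩ := (Function.factorsThrough_iff Y).1 h
  exact entropy_comp_le hX f

theorem entropy_le_logb_card [IsProbabilityMeasure P] (hX : Measurable X) :
    entropy P X ≤ Real.logb 2 (Fintype.card α) := by
  have : Nonempty α := (nonempty_of_isProbabilityMeasure P).map X
  have gibbs := sum_mul_logb_le_sum_mul_logb (s := Finset.univ)
    (p := fun a => P.real {ω | X ω = a}) (q := fun _ => (Fintype.card α : ℝ)⁻¹)
    (fun _ _ => measureReal_nonneg) (fun _ _ => by positivity)
    (fun _ _ h => absurd h (by positivity)) (by simp [sum_measureReal_eq_one hX])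
  rw [← Finset.sum_mul, sum_measureReal_eq_one hX, one_mul, Real.logb_inv] at gibbs
  exact neg_le.1 gibbs

variable [MeasurableSpace β] [MeasurableSingletonClass β]

theorem condEntropy_eq_entropy_sub [IsFiniteMeasure P] (hX : Measurable X)
    (hY : Measurable Y) :
    condEntropy P X Y = entropy P (fun ω => (X ω, Y ω)) - entropy P Y := by
  have marginal : entropy P Y = _ := entropy_comp (hX.prodMk hY) Prod.snd
  rw [marginal, entropy, condEntropy, ← Fintype.sum_prod_type', neg_sub_neg,
    ← Finset.sum_sub_distrib]
  refine Finset.sum_congr rfl fun ⟨x, y⟩ _ => ?_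
  simp only [Prod.mk.injEq]
  rcases (measureReal_nonneg (μ := P) (s := {ω | X ω = x ∧ Y ω = y})).eq_or_lt with h | h
  · simp [← h]
  · have hy : 0 < P.real {ω | Y ω = y} := h.trans_le (measureReal_mono fun _ => And.right)
    rw [Real.logb_div hy.ne' h.ne', mul_sub]

theorem condEntropy_nonneg [IsFiniteMeasure P] (hX : Measurable X)
    (hY : Measurable Y) : 0 ≤ condEntropy P X Y := by
  rw [condEntropy_eq_entropy_sub hX hY, sub_nonneg]
  exact entropy_comp_le (hX.prodMk hY) Prod.snd

theorem entropy_prodMk_of_indepFun [IsFiniteMeasure P] (hX : Measurable X)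
    (hY : Measurable Y) (h : IndepFun X Y P) :
    entropy P (fun ω => (X ω, Y ω)) = entropy P X + entropy P Y := by
  have left : entropy P X = _ := entropy_comp (hX.prodMk hY) Prod.fst
  have right : entropy P Y = _ := entropy_comp (hX.prodMk hY) Prod.snd
  rw [left, right, entropy, ← neg_add, ← Finset.sum_add_distrib]
  congr! 2 with ⟨x, y⟩
  have product : P.real {ω | (X ω, Y ω) = (x, y)} =
      P.real {ω | X ω = x} * P.real {ω | Y ω = y} := by
    simp only [Prod.mk.injEq]
    exact (congrArg ENNReal.toReal (h.measure_inter_preimage_eq_mul {x} {y}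
      (measurableSet_singleton x) (measurableSet_singleton y))).trans ENNReal.toReal_mul
  rcases eq_or_ne (P.real {ω | X ω = x}) 0 with hx | hx
  · rw [product, hx, zero_mul, zero_mul, zero_mul, add_zero]
  rcases eq_or_ne (P.real {ω | Y ω = y}) 0 with hy | hy
  · rw [product, hy, mul_zero, zero_mul, zero_mul, add_zero]
  rw [product, Real.logb_mul hx hy, mul_add]

theorem condEntropy_eq_entropy_of_indepFun [IsFiniteMeasure P] (hX : Measurable X)
    (hY : Measurable Y) (h : IndepFun X Y P) : condEntropy P X Y = entropy P X := by
  rw [condEntropy_eq_entropy_sub hX hY, entropy_prodMk_of_indepFun hX hY h, add_sub_cancel_right]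

variable [IsProbabilityMeasure P]

theorem entropy_eq_of_factorsThrough (hX : Measurable X) (hY : Measurable Y)
    (hYX : Y.FactorsThrough X) (hXY : X.FactorsThrough Y) : entropy P Y = entropy P X :=
  le_antisymm (entropy_le_of_factorsThrough hX hYX) (entropy_le_of_factorsThrough hY hXY)

variable [Fintype γ] [MeasurableSpace γ] [MeasurableSingletonClass γ]

theorem sum_measureReal_mul_measureReal_div_le_one (hX : Measurable X) (hY : Measurable Y)
    (hZ : Measurable Z) :
    ∑ t : α × β × γ, P.real {ω | (X ω, Z ω) = (t.1, t.2.2)} * P.real {ω | (Y ω, Z ω) = t.2} /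
      P.real {ω | Z ω = t.2.2} ≤ 1 :=
  calc _ = ∑ t : β × γ, (∑ x, P.real {ω | (X ω, Z ω) = (x, t.2)}) / P.real {ω | Z ω = t.2} *
          P.real {ω | (Y ω, Z ω) = t} := by
        rw [Fintype.sum_prod_type_right]
        simp only [Finset.sum_div, Finset.sum_mul, div_mul_eq_mul_div]
    _ ≤ ∑ t, P.real {ω | (Y ω, Z ω) = t} := by
        refine Finset.sum_le_sum fun t _ => mul_le_of_le_one_left measureReal_nonneg ?_
        rw [sum_measureReal_prodMk hX t.2]
        exact div_self_le_one _
    _ = 1 := sum_measureReal_eq_one (hY.prodMk hZ)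

/-- Gibbs' inequality for the joint law of `(X, Y, Z)` against the law under which `X` and `Y` are
conditionally independent given `Z`. -/
theorem entropy_add_entropy_le (hX : Measurable X) (hY : Measurable Y) (hZ : Measurable Z) :
    entropy P (fun ω => (X ω, Y ω, Z ω)) + entropy P Z ≤
      entropy P (fun ω => (X ω, Z ω)) + entropy P (fun ω => (Y ω, Z ω)) := by
  set T : Ω → α × β × γ := fun ω => (X ω, Y ω, Z ω)
  have hT : Measurable T := hX.prodMk (hY.prodMk hZ)
  set p : α × β × γ → ℝ := fun t => P.real {ω | T ω = t}
  set a : α × β × γ → ℝ := fun t => P.real {ω | (X ω, Z ω) = (t.1, t.2.2)}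
  set b : α × β × γ → ℝ := fun t => P.real {ω | (Y ω, Z ω) = t.2}
  set c : α × β × γ → ℝ := fun t => P.real {ω | Z ω = t.2.2}
  have entropy_T : entropy P T = -∑ t, p t * Real.logb 2 (p t) := rfl
  have entropy_XZ : entropy P (fun ω => (X ω, Z ω)) = -∑ t, p t * Real.logb 2 (a t) :=
    entropy_comp hT fun t => (t.1, t.2.2)
  have entropy_YZ : entropy P (fun ω => (Y ω, Z ω)) = -∑ t, p t * Real.logb 2 (b t) :=
    entropy_comp hT fun t => t.2
  have entropy_Z : entropy P Z = -∑ t, p t * Real.logb 2 (c t) := entropy_comp hT fun t => t.2.2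
  have pos {t} (ht : p t ≠ 0) : 0 < a t ∧ 0 < b t ∧ 0 < c t := by
    have ht : 0 < p t := lt_of_le_of_ne measureReal_nonneg ht.symm
    exact ⟨ht.trans_le (measureReal_le_measureReal_comp (X := T) (fun t => (t.1, t.2.2)) t),
      ht.trans_le (measureReal_le_measureReal_comp (X := T) (fun t => t.2) t),
      ht.trans_le (measureReal_le_measureReal_comp (X := T) (fun t => t.2.2) t)⟩
  have gibbs : ∑ t, p t * Real.logb 2 (a t * b t / c t) ≤ ∑ t, p t * Real.logb 2 (p t) := by
    refine sum_mul_logb_le_sum_mul_logb (fun _ _ => measureReal_nonneg) (fun _ _ => by positivity)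
      (fun t _ h => by_contra fun ht => ?_)
      ((sum_measureReal_mul_measureReal_div_le_one hX hY hZ).trans_eq
        (sum_measureReal_eq_one hT).symm)
    obtain ⟨ha, hb, hc⟩ := pos ht
    exact absurd h (by positivity)
  have expand t : p t * Real.logb 2 (a t * b t / c t) =
      p t * Real.logb 2 (a t) + p t * Real.logb 2 (b t) - p t * Real.logb 2 (c t) := by
    by_cases ht : p t = 0
    · simp [ht]
    · obtain ⟨ha, hb, hc⟩ := pos ht
      rw [Real.logb_div (mul_pos ha hb).ne' hc.ne', Real.logb_mul ha.ne' hb.ne']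
      ring
  simp only [expand, Finset.sum_sub_distrib, Finset.sum_add_distrib] at gibbs
  linarith

theorem condEntropy_prodMk (hX : Measurable X) (hY : Measurable Y) (hZ : Measurable Z) :
    condEntropy P (fun ω => (X ω, Y ω)) Z =
      condEntropy P X (fun ω => (Y ω, Z ω)) + condEntropy P Y Z := by
  have assoc : entropy P (fun ω => ((X ω, Y ω), Z ω)) = entropy P (fun ω => (X ω, Y ω, Z ω)) :=
    entropy_eq_of_factorsThrough (by fun_prop) (by fun_prop) (fun _ _ h => by simp_all)
      fun _ _ h => by simp_all
  rw [condEntropy_eq_entropy_sub (hX.prodMk hY) hZ, condEntropy_eq_entropy_sub hX (hY.prodMk hZ),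
    condEntropy_eq_entropy_sub hY hZ, assoc]
  ring

theorem condEntropy_le_of_factorsThrough_right (hX : Measurable X) (hY : Measurable Y)
    (hZ : Measurable Z) (h : Z.FactorsThrough Y) : condEntropy P X Y ≤ condEntropy P X Z := by
  have submodular := entropy_add_entropy_le (P := P) hX hY hZ
  have absorb : entropy P (fun ω => (Y ω, Z ω)) = entropy P Y :=
    entropy_eq_of_factorsThrough hY (by fun_prop) (fun _ _ e => Prod.ext e (h e))
      fun _ _ e => congrArg Prod.fst e
  have absorb' : entropy P (fun ω => (X ω, Y ω)) = entropy P (fun ω => (X ω, Y ω, Z ω)) :=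
    entropy_eq_of_factorsThrough (by fun_prop) (by fun_prop) (fun _ _ e => by simp_all)
      fun _ _ e => by
        obtain ⟨eX, eY⟩ := Prod.mk.inj e
        exact Prod.ext eX (Prod.ext eY (h eY))
  rw [condEntropy_eq_entropy_sub hX hY, condEntropy_eq_entropy_sub hX hZ]
  linarith

theorem condEntropy_le_entropy (hX : Measurable X) (hY : Measurable Y) :
    condEntropy P X Y ≤ entropy P X := by
  have trivial_conditioning : condEntropy P X (fun _ => ()) = entropy P X :=
    condEntropy_eq_entropy_of_indepFun hX measurable_const (indepFun_const_right X ())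
  exact trivial_conditioning ▸
    condEntropy_le_of_factorsThrough_right hX hY measurable_const fun _ _ _ => rfl

theorem condEntropy_le_of_factorsThrough_left (hX : Measurable X) (hY : Measurable Y)
    (hZ : Measurable Z) (h : X.FactorsThrough (fun ω => (Y ω, Z ω))) :
    condEntropy P X Z ≤ condEntropy P Y Z := by
  have factors : (fun ω => (X ω, Z ω)).FactorsThrough (fun ω => (Y ω, Z ω)) :=
    fun _ _ e => Prod.ext (h e) (Prod.mk.inj e).2
  rw [condEntropy_eq_entropy_sub hX hZ, condEntropy_eq_entropy_sub hY hZ]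
  gcongr
  exact entropy_le_of_factorsThrough (hY.prodMk hZ) factors

theorem condEntropy_add_condEntropy_comm (hX : Measurable X) (hY : Measurable Y)
    (hZ : Measurable Z) :
    condEntropy P X (fun ω => (Y ω, Z ω)) + condEntropy P Y Z =
      condEntropy P Y (fun ω => (X ω, Z ω)) + condEntropy P X Z := by
  rw [← condEntropy_prodMk hX hY hZ, ← condEntropy_prodMk hY hX hZ]
  refine le_antisymm ?_ ?_ <;>
    exact condEntropy_le_of_factorsThrough_left (by fun_prop) (by fun_prop) hZ fun _ _ e => by
      simp_all

theorem condEntropy_prodMk_le (hX : Measurable X) (hY : Measurable Y) (hZ : Measurable Z) :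
    condEntropy P (fun ω => (X ω, Y ω)) Z ≤ condEntropy P X Z + condEntropy P Y Z := by
  rw [condEntropy_prodMk hX hY hZ]
  gcongr
  exact condEntropy_le_of_factorsThrough_right hX (hY.prodMk hZ) hZ
    fun _ _ e => congrArg Prod.snd e

theorem condEntropy_le_condEntropy_add (hX : Measurable X) (hY : Measurable Y)
    (hZ : Measurable Z) :
    condEntropy P X Z ≤ condEntropy P X (fun ω => (Y ω, Z ω)) + condEntropy P Y Z := by
  rw [condEntropy_add_condEntropy_comm hX hY hZ]
  exact le_add_of_nonneg_left (condEntropy_nonneg hY (hX.prodMk hZ))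

theorem condEntropy_pi_le_sum {ι : Type*} [Fintype ι] [DecidableEq ι] {E : ι → Type*}
    [∀ i, Fintype (E i)] [∀ i, MeasurableSpace (E i)] [∀ i, MeasurableSingletonClass (E i)]
    {A : ∀ i, Ω → E i} (hA : ∀ i, Measurable (A i)) (hX : Measurable X) :
    condEntropy P (fun ω i => A i ω) X ≤ ∑ i, condEntropy P (A i) X := by
  have restrict_le (s : Finset ι) :
      condEntropy P (fun ω => s.restrict fun i => A i ω) X ≤ ∑ i ∈ s, condEntropy P (A i) X := by
    have measurable_restrict (s : Finset ι) : Measurable fun ω => s.restrict fun i => A i ω :=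
      measurable_pi_lambda _ fun i => hA i
    induction s using Finset.induction_on with
    | empty =>
      refine (condEntropy_le_entropy (measurable_restrict ∅) hX).trans_eq ?_
      exact Eq.trans (congrArg _ (Subsingleton.elim _ _)) (entropy_const fun i => isEmptyElim i)
    | insert i s hi ih =>
      rw [Finset.sum_insert hi]
      refine le_trans ?_ ((condEntropy_prodMk_le (hA i) (measurable_restrict s) hX).trans
        (by gcongr))
      refine condEntropy_le_of_factorsThrough_left (measurable_restrict _)
        ((hA i).prodMk (measurable_restrict s)) hX fun ω ω' e => funext fun ⟨j, hj⟩ => ?_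
      simp only [Prod.mk.injEq] at e
      rcases Finset.mem_insert.1 hj with rfl | hj
      · exact e.1.1
      · exact congrFun e.1.2 ⟨j, hj⟩
  refine le_trans ?_ (restrict_le Finset.univ)
  exact condEntropy_le_of_factorsThrough_left (by fun_prop)
    (measurable_pi_lambda _ fun i => hA i) hX fun ω ω' e => funext fun i =>
      congrFun (Prod.mk.inj e).1 ⟨i, Finset.mem_univ i⟩

theorem condEntropy_prodMk_right_of_indepFun (hX : Measurable X) (hY : Measurable Y)
    (hZ : Measurable Z) (h : IndepFun Y (fun ω => (X ω, Z ω)) P) :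
    condEntropy P X (fun ω => (Y ω, Z ω)) = condEntropy P X Z := by
  have exchange := condEntropy_add_condEntropy_comm (P := P) hX hY hZ
  have hYZ : IndepFun Y Z P := h.comp measurable_id measurable_snd
  rw [condEntropy_eq_entropy_of_indepFun hY hZ hYZ,
    condEntropy_eq_entropy_of_indepFun hY (hX.prodMk hZ) h] at exchange
  linarith

/-- By independence `H(W | U, V) = H(W | G, V)`, while knowing `G` instead of `U` can only lower
the uncertainty about `W` that is left once `A` is revealed. -/
theorem condEntropy_prodMk_le_of_indepFun {δ ε : Type*} [Fintype δ] [MeasurableSpace δ]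
    [MeasurableSingletonClass δ] [Fintype ε] [MeasurableSpace ε]
    [MeasurableSingletonClass ε] {A : Ω → α} {G : Ω → β} {W : Ω → γ} {U : Ω → δ} {V : Ω → ε}
    (hA : Measurable A) (hG : Measurable G) (hW : Measurable W) (hU : Measurable U)
    (hV : Measurable V) (h : IndepFun G W P) (hUG : U.FactorsThrough G) (hVW : V.FactorsThrough W)
    (hAUW : condEntropy P A (fun ω => (U ω, W ω)) = 0) :
    condEntropy P A (fun ω => (U ω, V ω)) ≤ condEntropy P A (fun ω => (G ω, V ω)) := by
  have : Nonempty δ := (nonempty_of_isProbabilityMeasure P).map U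
  have : Nonempty ε := (nonempty_of_isProbabilityMeasure P).map V
  obtain ⟨u, rfl⟩ := (Function.factorsThrough_iff U).1 hUG
  obtain ⟨v, rfl⟩ := (Function.factorsThrough_iff V).1 hVW
  have indep_G : IndepFun G (fun ω => (W ω, v (W ω))) P :=
    h.comp measurable_id (measurable_of_finite fun w => (w, v w))
  have indep_U : IndepFun (u ∘ G) (fun ω => (W ω, v (W ω))) P :=
    indep_G.comp (measurable_of_finite u) measurable_id
  have exchange_U := condEntropy_add_condEntropy_comm (P := P) hA hW (hU.prodMk hV)
  have exchange_G := condEntropy_add_condEntropy_comm (P := P) hA hW (hG.prodMk hV)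
  have determined : condEntropy P A (fun ω => (W ω, (u ∘ G) ω, (v ∘ W) ω)) ≤ 0 :=
    hAUW ▸ condEntropy_le_of_factorsThrough_right hA (hW.prodMk (hU.prodMk hV)) (hU.prodMk hW)
      fun _ _ e => by simp_all
  have refine_G : condEntropy P W (fun ω => (A ω, G ω, (v ∘ W) ω)) ≤
      condEntropy P W (fun ω => (A ω, (u ∘ G) ω, (v ∘ W) ω)) :=
    condEntropy_le_of_factorsThrough_right hW (by fun_prop) (by fun_prop) fun _ _ e => by simp_all
  have uncoupled_U := condEntropy_prodMk_right_of_indepFun hW hU hV indep_U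
  have uncoupled_G := condEntropy_prodMk_right_of_indepFun hW hG hV indep_G
  have nonneg := condEntropy_nonneg (P := P) hA (hW.prodMk (hG.prodMk hV))
  linarith

end Entropy

section Lines

/-- The affine function of the caching ratio `r` that bounds the download cost when `m` messages
besides the desired one are unknown to the user: `innerLine N K i` with `m = K + 1 - i`. -/
def line (N : ℝ) (m : ℕ) (r : ℝ) : ℝ :=
  (1 - r) * ∑ j ∈ Finset.range (m + 1), 1 / N ^ j - r * ∑ j ∈ Finset.range m, ((m : ℝ) - j) / N ^ j

/-- The caching ratio at which `line N m` and `line N (m - 1)` cross: `corner N K s` with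
`m = K - s`. -/
def breakpoint (N : ℝ) (m : ℕ) : ℝ := 1 / ∑ j ∈ Finset.range (m + 1), N ^ j

theorem innerLine_eq_line (N : ℕ) {K i : ℕ} (hi : i ≤ K + 1) (r : ℝ) :
    innerLine N K i r = line N (K + 1 - i) r := by
  rw [innerLine, line, Nat.cast_sub hi, Nat.succ_sub hi]
  push_cast
  rfl

theorem corner_eq_breakpoint (N K : ℕ) {s : ℕ} (hs : s ≠ 0) :
    corner N K s = breakpoint N (K - s) :=
  if_neg hs

theorem line_zero (N r : ℝ) : line N 0 r = 1 - r := by simp [line]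

theorem breakpoint_zero (N : ℝ) : breakpoint N 0 = 1 := by simp [breakpoint]

variable {N : ℝ}

theorem line_succ (N : ℝ) (m : ℕ) (r : ℝ) :
    line N (m + 1) r = (1 - r) + line N m r / N - r * (m + 1) := by
  have powers : ∑ j ∈ Finset.range (m + 2), 1 / N ^ j =
      (∑ j ∈ Finset.range (m + 1), 1 / N ^ j) / N + 1 := by
    simp [Finset.sum_range_succ' _ (m + 1), Finset.mul_sum, pow_succ, div_eq_mul_inv, mul_comm]
  have weights : ∑ j ∈ Finset.range (m + 1), (((m + 1 : ℕ) : ℝ) - j) / N ^ j =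
      (∑ j ∈ Finset.range m, ((m : ℝ) - j) / N ^ j) / N + (m + 1) := by
    simp [Finset.sum_range_succ' _ m, Finset.sum_div, pow_succ, div_div]
  rw [line, line, powers, weights]
  ring

theorem line_succ_sub_line (hN : 0 < N) (m : ℕ) (r : ℝ) :
    line N (m + 1) r - line N m r =
      (breakpoint N (m + 1) - r) * ((∑ j ∈ Finset.range (m + 2), N ^ j) / N ^ (m + 1)) := by
  have increment : line N (m + 1) r - line N m r =
      (1 - r * ∑ j ∈ Finset.range (m + 2), N ^ j) / N ^ (m + 1) := by
    induction m with
    | zero =>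
      simp only [line_succ, line_zero, Finset.sum_range_succ, Finset.sum_range_zero]
      field_simp
      norm_num
      ring
    | succ m ih =>
      calc line N (m + 2) r - line N (m + 1) r
          = (line N (m + 1) r - line N m r) / N - r := by
            rw [line_succ N (m + 1), line_succ N m]
            push_cast
            ring
        _ = (1 - r * ∑ j ∈ Finset.range (m + 3), N ^ j) / N ^ (m + 2) := by
            rw [ih, Finset.sum_range_succ _ (m + 2)]
            field_simp
            ring
  rw [increment, breakpoint]
  field_simp [(geom_sum_pos hN.le (m + 1).succ_ne_zero).ne']

theorem breakpoint_strictAnti (hN : 0 < N) : StrictAnti (breakpoint N) := by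
  refine strictAnti_nat_of_succ_lt fun m =>
    one_div_lt_one_div_of_lt (geom_sum_pos hN.le m.succ_ne_zero) ?_
  rw [Finset.sum_range_succ _ (m + 1)]
  exact lt_add_of_pos_right _ (by positivity)

theorem line_le_line_of_le_breakpoint (hN : 0 < N) {j m : ℕ} {r : ℝ} (hjm : j ≤ m)
    (hr : r ≤ breakpoint N m) : line N j r ≤ line N m r := by
  induction m, hjm using Nat.le_induction with
  | base => exact le_rfl
  | succ m _ ih =>
    refine (ih (hr.trans (breakpoint_strictAnti hN m.lt_succ_self).le)).trans (sub_nonneg.1 ?_)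
    rw [line_succ_sub_line hN]
    exact mul_nonneg (sub_nonneg.2 hr) (by positivity)

theorem line_le_line_of_breakpoint_le (hN : 0 < N) {m j : ℕ} {r : ℝ} (hmj : m ≤ j)
    (hr : breakpoint N (m + 1) ≤ r) : line N j r ≤ line N m r := by
  induction j, hmj using Nat.le_induction with
  | base => exact le_rfl
  | succ j hmj ih =>
    have hjr : breakpoint N (j + 1) ≤ r :=
      ((breakpoint_strictAnti hN).antitone (by gcongr)).trans hr
    refine (sub_nonpos.1 ?_).trans ih
    rw [line_succ_sub_line hN]
    exact mul_nonpos_of_nonpos_of_nonneg (sub_nonpos.2 hjr) (by positivity)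

theorem corner_self {K : ℕ} (N : ℕ) (hK : K ≠ 0) : corner N K K = 1 := by
  rw [corner_eq_breakpoint N K hK, Nat.sub_self, breakpoint_zero]

theorem corner_lt_corner_succ {N K s : ℕ} (hN : 0 < N) (hs : s < K) :
    corner N K s < corner N K (s + 1) := by
  have hN' : (0 : ℝ) < N := by exact_mod_cast hN
  rw [corner_eq_breakpoint N K s.succ_ne_zero]
  rcases eq_or_ne s 0 with rfl | hs0
  · exact one_div_pos.2 (geom_sum_pos hN'.le (Nat.succ_ne_zero _))
  · rw [corner_eq_breakpoint N K hs0]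
    exact breakpoint_strictAnti hN' (by lia)

theorem innerBound_eq_innerLine {N K s : ℕ} (hN : 0 < N) (hK : 1 ≤ K) (hs : s < K) {r : ℝ}
    (hr : corner N K s ≤ r) (hr' : r ≤ corner N K (s + 1)) :
    innerBound N K hK r = innerLine N K (s + 2) r := by
  have hN' : (0 : ℝ) < N := by exact_mod_cast hN
  rw [corner_eq_breakpoint N K s.succ_ne_zero] at hr'
  refine le_antisymm (Finset.sup'_le _ _ fun i hi => ?_)
    (Finset.le_sup' (fun i => innerLine N K i r) (Finset.mem_Icc.2 ⟨by lia, by lia⟩))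
  obtain ⟨hi, hiK⟩ := Finset.mem_Icc.1 hi
  rw [innerLine_eq_line N hiK, innerLine_eq_line N (by lia)]
  rcases le_total (s + 2) i with hsi | hsi
  · exact line_le_line_of_le_breakpoint hN' (by lia)
      (hr'.trans_eq (congrArg _ (by lia)))
  · rcases eq_or_ne s 0 with rfl | hs0
    · rw [show i = 2 by lia]
    · rw [corner_eq_breakpoint N K hs0] at hr
      exact line_le_line_of_breakpoint_le hN' (by lia) (le_of_eq_of_le (congrArg _ (by lia)) hr)

theorem innerLine_slope_lt {N K s : ℕ} (hN : 0 < N) (hs : s + 1 < K) :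
    innerLine N K (s + 2) 1 - innerLine N K (s + 2) 0 <
      innerLine N K (s + 3) 1 - innerLine N K (s + 3) 0 := by
  have hN' : (0 : ℝ) < N := by exact_mod_cast hN
  obtain ⟨m, rfl⟩ := Nat.exists_eq_add_of_lt hs
  have at_one := line_succ_sub_line hN' m 1
  have at_zero := line_succ_sub_line hN' m 0
  have geom_pos : 0 < (∑ j ∈ Finset.range (m + 2), (N : ℝ) ^ j) / N ^ (m + 1) :=
    div_pos (geom_sum_pos hN'.le (Nat.succ_ne_zero _)) (by positivity)
  simp only [innerLine_eq_line N (show s + 2 ≤ s + 1 + m + 1 + 1 by lia),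
    innerLine_eq_line N (show s + 3 ≤ s + 1 + m + 1 + 1 by lia),
    show s + 1 + m + 1 + 1 - (s + 2) = m + 1 by lia, show s + 1 + m + 1 + 1 - (s + 3) = m by lia]
  linarith

end Lines

namespace Scheme

variable {N K L c : ℕ} (S : Scheme N K L c)

attribute [fun_prop] measurable_W measurable_idx measurable_Q measurable_A

/-- The part of the user's knowledge that is independent of the messages: the cached positions and
the queries when message `k` is desired. -/
def randomness (k : Fin K) (ω : S.Ω) : (Fin K → Fin c → Fin L) × (Fin N → Fin S.q) :=
  (S.idx ω, fun n => S.Q k n ω)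

/-- The tuple of the messages with index in `s`. -/
def messages (s : Finset (Fin K)) (ω : S.Ω) : s → Fin L → Bool := s.restrict fun i => S.W i ω

/-- The tuple of all answers when message `k` is desired. -/
def answers (k : Fin K) (ω : S.Ω) : Fin N → Fin S.a := fun n => S.A k n ω

/-- The uncertainty about the answers that is left to the user who desires message `k` and also
knows the messages with index in `s`. -/
def answerEntropy (k : Fin K) (s : Finset (Fin K)) : ℝ :=
  condEntropy S.P (S.answers k) (fun ω => (S.Z ω, S.randomness k ω, S.messages s ω))

/-- The uncertainty about the answer of database `n`, given its query and the messages with index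
in `s`; by privacy it does not depend on `k`. -/
def serverEntropy (k : Fin K) (n : Fin N) (s : Finset (Fin K)) : ℝ :=
  condEntropy S.P (S.A k n) (fun ω => (S.Q k n ω, S.messages s ω))

@[fun_prop]
theorem measurable_randomness (k : Fin K) : Measurable (S.randomness k) := by
  unfold randomness
  fun_prop

@[fun_prop]
theorem measurable_messages (s : Finset (Fin K)) : Measurable (S.messages s) :=
  measurable_pi_lambda _ fun i => S.measurable_W i

@[fun_prop]
theorem measurable_answers (k : Fin K) : Measurable (S.answers k) := by
  unfold answers
  fun_prop

theorem Z_eq_of_eq {ω ω' : S.Ω} (hidx : S.idx ω = S.idx ω') {i : Fin K} (hW : S.W i ω = S.W i ω') :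
    S.Z ω i = S.Z ω' i := by
  funext j
  rw [Z, Z, hidx, hW]

@[fun_prop]
theorem measurable_Z : Measurable S.Z := by
  have evaluation : Measurable fun t : (Fin K → Fin c → Fin L) × (Fin K → Fin L → Bool) =>
      fun i j => t.2 i (t.1 i j) := measurable_of_finite _
  exact evaluation.comp (by fun_prop : Measurable fun ω => (S.idx ω, fun i => S.W i ω))

theorem messages_factorsThrough {s t : Finset (Fin K)} (h : s ⊆ t) :
    (S.messages s).FactorsThrough (S.messages t) :=
  fun _ _ e => funext fun i => congrFun e ⟨i, h i.2⟩

theorem messages_factorsThrough_all (s : Finset (Fin K)) :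
    (S.messages s).FactorsThrough fun ω i => S.W i ω :=
  fun _ _ e => funext fun i => congrFun e i

theorem condEntropy_Z_le (k : Fin K) (s : Finset (Fin K)) :
    condEntropy S.P S.Z (fun ω => (S.randomness k ω, S.messages s ω)) ≤ sᶜ.card * c := by
  let cached : S.Ω → (sᶜ : Finset (Fin K)) → Fin c → Bool := fun ω i => S.Z ω i
  have measurable_cached : Measurable cached := by fun_prop
  calc condEntropy S.P S.Z (fun ω => (S.randomness k ω, S.messages s ω))
      ≤ condEntropy S.P cached (fun ω => (S.randomness k ω, S.messages s ω)) := by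
        refine condEntropy_le_of_factorsThrough_left (by fun_prop) measurable_cached (by fun_prop)
          fun ω ω' e => funext fun i => ?_
        simp only [Prod.mk.injEq, randomness] at e
        by_cases hi : i ∈ s
        · exact S.Z_eq_of_eq e.2.1.1 (congrFun e.2.2 ⟨i, hi⟩)
        · exact congrFun e.1 ⟨i, Finset.mem_compl.2 hi⟩
    _ ≤ entropy S.P cached := condEntropy_le_entropy measurable_cached (by fun_prop)
    _ ≤ Real.logb 2 (Fintype.card ((sᶜ : Finset (Fin K)) → Fin c → Bool)) :=
        entropy_le_logb_card measurable_cached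
    _ = sᶜ.card * c := by
        simp only [Fintype.card_fun, Fintype.card_coe, Fintype.card_fin, Fintype.card_bool]
        rw [← pow_mul, Nat.cast_pow, Real.logb_pow, Nat.cast_two, Real.logb_self_eq_one one_lt_two]
        push_cast
        ring

theorem condEntropy_W_eq (k : Fin K) {i : Fin K} {s : Finset (Fin K)} (hi : i ∉ s) :
    condEntropy S.P (S.W i) (fun ω => (S.randomness k ω, S.messages s ω)) = L := by
  have disjoint : Disjoint {i} s := Finset.disjoint_singleton_left.2 hi
  have indep_messages : IndepFun (S.W i) (S.messages s) S.P :=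
    (S.indep_W.indepFun_finset {i} s disjoint S.measurable_W).comp
      (φ := fun w : ({i} : Finset (Fin K)) → Fin L → Bool => w ⟨i, Finset.mem_singleton_self i⟩)
      (measurable_of_finite _) measurable_id
  have indep_randomness : IndepFun (S.randomness k) (fun ω => (S.W i ω, S.messages s ω)) S.P :=
    (S.indep_query k).comp (ψ := fun w : Fin K → Fin L → Bool => (w i, s.restrict w)) measurable_id
      (measurable_of_finite _)
  rw [condEntropy_prodMk_right_of_indepFun (by fun_prop) (by fun_prop) (by fun_prop)
      indep_randomness,
    condEntropy_eq_entropy_of_indepFun (by fun_prop) (by fun_prop) indep_messages, S.entropy_W]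

theorem le_condEntropy_W (k : Fin K) {i : Fin K} {s : Finset (Fin K)} (hi : i ∉ s) :
    (L : ℝ) - c ≤
      condEntropy S.P (S.W i) (fun ω => (S.Z ω, S.randomness k ω, S.messages s ω)) := by
  have cache_le : condEntropy S.P S.Z (fun ω => (S.randomness k ω, S.messages {i}ᶜ ω)) ≤ c := by
    simpa using S.condEntropy_Z_le k {i}ᶜ
  calc (L : ℝ) - c
      ≤ condEntropy S.P (S.W i) (fun ω => (S.randomness k ω, S.messages {i}ᶜ ω)) -
          condEntropy S.P S.Z (fun ω => (S.randomness k ω, S.messages {i}ᶜ ω)) := by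
        rw [S.condEntropy_W_eq k (by simp)]
        gcongr
    _ ≤ condEntropy S.P (S.W i) (fun ω => (S.Z ω, S.randomness k ω, S.messages {i}ᶜ ω)) :=
        sub_le_iff_le_add.2
          (condEntropy_le_condEntropy_add (by fun_prop) (by fun_prop) (by fun_prop))
    _ ≤ condEntropy S.P (S.W i) (fun ω => (S.Z ω, S.randomness k ω, S.messages s ω)) := by
        refine condEntropy_le_of_factorsThrough_right (by fun_prop) (by fun_prop) (by fun_prop)
          fun ω ω' e => ?_
        obtain ⟨eZ, e'⟩ := Prod.mk.inj e
        obtain ⟨er, em⟩ := Prod.mk.inj e'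
        exact Prod.ext eZ (Prod.ext er (S.messages_factorsThrough (by simpa using hi) em))

theorem add_answerEntropy_insert_le {k : Fin K} {s : Finset (Fin K)} (hk : k ∉ s) :
    (L : ℝ) - c + S.answerEntropy k (insert k s) - S.equivocation k ≤ S.answerEntropy k s := by
  have exchange := condEntropy_add_condEntropy_comm (P := S.P) (S.measurable_answers k)
    (S.measurable_W k)
    (by fun_prop : Measurable fun ω => (S.Z ω, S.randomness k ω, S.messages s ω))
  have undecoded : condEntropy S.P (S.W k)
      (fun ω => (S.answers k ω, S.Z ω, S.randomness k ω, S.messages s ω)) ≤ S.equivocation k :=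
    condEntropy_le_of_factorsThrough_right (by fun_prop) (by fun_prop) (by fun_prop)
      fun ω ω' e => by
        simp only [Prod.mk.injEq, randomness] at e ⊢
        exact ⟨e.2.1, e.2.2.1.1, e.2.2.1.2, e.1⟩
  have decoded : S.answerEntropy k (insert k s) ≤ condEntropy S.P (S.answers k)
      (fun ω => (S.W k ω, S.Z ω, S.randomness k ω, S.messages s ω)) :=
    condEntropy_le_of_factorsThrough_right (by fun_prop) (by fun_prop) (by fun_prop)
      fun ω ω' e => by
        simp only [Prod.mk.injEq] at e ⊢
        exact ⟨congrFun e.2.2 ⟨k, Finset.mem_insert_self k s⟩, e.1, e.2.1,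
          S.messages_factorsThrough (Finset.subset_insert k s) e.2.2⟩
  have message_le := S.le_condEntropy_W k hk
  unfold answerEntropy at decoded ⊢
  linarith

theorem serverEntropy_eq (k k' : Fin K) (n : Fin N) (s : Finset (Fin K)) :
    S.serverEntropy k n s = S.serverEntropy k' n s := by
  have law_eq := (S.privacy n k k').comp (u := fun t => (t.2.1, t.1, s.restrict t.2.2))
    (measurable_of_finite _)
  have law_eq' := (S.privacy n k k').comp (u := fun t => (t.1, s.restrict t.2.2))
    (measurable_of_finite _)
  rw [serverEntropy, serverEntropy, condEntropy_eq_entropy_sub (by fun_prop) (by fun_prop),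
    condEntropy_eq_entropy_sub (by fun_prop) (by fun_prop)]
  exact congrArg₂ _ (entropy_eq_of_identDistrib law_eq) (entropy_eq_of_identDistrib law_eq')

theorem answerEntropy_le_sum_serverEntropy (k : Fin K) (s : Finset (Fin K)) :
    S.answerEntropy k s ≤ ∑ n, S.serverEntropy k n s := by
  refine (condEntropy_pi_le_sum (S.measurable_A k) (by fun_prop)).trans
    (Finset.sum_le_sum fun n _ => ?_)
  refine condEntropy_le_of_factorsThrough_right (by fun_prop) (by fun_prop) (by fun_prop)
    fun ω ω' e => ?_
  simp only [Prod.mk.injEq, randomness] at e ⊢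
  exact ⟨congrFun e.2.1.2 n, e.2.2⟩

theorem answerEntropy_le_downloadCost (k : Fin K) (s : Finset (Fin K)) :
    S.answerEntropy k s ≤ S.downloadCost k :=
  (S.answerEntropy_le_sum_serverEntropy k s).trans
    (Finset.sum_le_sum fun n _ => condEntropy_le_entropy (by fun_prop) (by fun_prop))

theorem serverEntropy_le_answerEntropy_add (k : Fin K) (n : Fin N) (s : Finset (Fin K)) :
    S.serverEntropy k n s ≤ S.answerEntropy k s + sᶜ.card * c := by
  calc S.serverEntropy k n s
      ≤ condEntropy S.P (S.A k n) (fun ω => (S.randomness k ω, S.messages s ω)) :=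
        condEntropy_prodMk_le_of_indepFun (W := fun ω i => S.W i ω) (by fun_prop) (by fun_prop)
          (by fun_prop) (by fun_prop) (by fun_prop) (S.indep_query k)
          (fun _ _ e => congrFun (Prod.mk.inj e).2 n) (S.messages_factorsThrough_all s)
          (S.answer k n)
    _ ≤ condEntropy S.P (S.answers k) (fun ω => (S.randomness k ω, S.messages s ω)) :=
        condEntropy_le_of_factorsThrough_left (by fun_prop) (by fun_prop) (by fun_prop)
          fun _ _ e => congrFun (Prod.mk.inj e).1 n
    _ ≤ condEntropy S.P (S.answers k) (fun ω => (S.Z ω, S.randomness k ω, S.messages s ω)) +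
          condEntropy S.P S.Z (fun ω => (S.randomness k ω, S.messages s ω)) :=
        condEntropy_le_condEntropy_add (by fun_prop) (by fun_prop) (by fun_prop)
    _ ≤ S.answerEntropy k s + sᶜ.card * c :=
        add_le_add_right (S.condEntropy_Z_le k s) _

theorem div_le_answerEntropy_add (hN : 0 < N) (k : Fin K) {i : Fin K} {s : Finset (Fin K)}
    (hi : i ∉ s) :
    ((L : ℝ) - c + S.answerEntropy i (insert i s) - S.equivocation i) / N ≤
      S.answerEntropy k s + sᶜ.card * c := by
  rw [div_le_iff₀' (by exact_mod_cast hN)]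
  calc (L : ℝ) - c + S.answerEntropy i (insert i s) - S.equivocation i
      ≤ S.answerEntropy i s := S.add_answerEntropy_insert_le hi
    _ ≤ ∑ n, S.serverEntropy i n s := S.answerEntropy_le_sum_serverEntropy i s
    _ = ∑ n, S.serverEntropy k n s := by simp only [S.serverEntropy_eq i k]
    _ ≤ ∑ _ : Fin N, (S.answerEntropy k s + sᶜ.card * c) :=
        Finset.sum_le_sum fun n _ => S.serverEntropy_le_answerEntropy_add k n s
    _ = N * (S.answerEntropy k s + sᶜ.card * c) := by simp [mul_add]

theorem equivocation_nonneg (k : Fin K) : 0 ≤ S.equivocation k :=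
  condEntropy_nonneg (by fun_prop) (by fun_prop)

theorem mul_line_sub_le (hN : 0 < N) {r : ℝ} (hc : (c : ℝ) ≤ r * L) (u : Finset (Fin K))
    (k : Fin K) :
    L * line N u.card r - ∑ i ∈ u, S.equivocation i ≤ L - c + S.answerEntropy k uᶜ := by
  induction u using Finset.induction_on generalizing k with
  | empty =>
    have answer_nonneg : 0 ≤ S.answerEntropy k ∅ᶜ := condEntropy_nonneg (by fun_prop) (by fun_prop)
    simp only [Finset.card_empty, line_zero, Finset.sum_empty]
    linarith
  | insert i u hi ih =>
    have recursion := S.div_le_answerEntropy_add hN k (i := i) (s := (insert i u)ᶜ) (by simp)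
    rw [Finset.insert_compl_insert hi, compl_compl, Finset.card_insert_of_notMem hi] at recursion
    have loss_nonneg : 0 ≤ ∑ j ∈ insert i u, S.equivocation j :=
      Finset.sum_nonneg fun j _ => S.equivocation_nonneg j
    have one_le_N : (1 : ℝ) ≤ N := by exact_mod_cast hN
    rw [Finset.card_insert_of_notMem hi]
    push_cast at recursion ⊢
    calc L * line N (u.card + 1) r - ∑ j ∈ insert i u, S.equivocation j
        ≤ L * line N (u.card + 1) r - (∑ j ∈ insert i u, S.equivocation j) / N := by
          gcongr
          exact div_le_self loss_nonneg one_le_N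
      _ = (L * line N u.card r - ∑ j ∈ u, S.equivocation j - S.equivocation i) / N +
            L - r * L * (u.card + 2) := by
          rw [line_succ, Finset.sum_insert hi]
          ring
      _ ≤ (L - c + S.answerEntropy i uᶜ - S.equivocation i) / N + L - c * (u.card + 2) := by
          gcongr
          exact ih i
      _ ≤ L - c + S.answerEntropy k (insert i u)ᶜ := by linarith

theorem mul_line_sub_le_downloadCost (hN : 0 < N) {r : ℝ} (hc : (c : ℝ) ≤ r * L)
    {u : Finset (Fin K)} {k : Fin K} (hk : k ∉ u) :
    L * line N u.card r - ∑ i ∈ insert k u, S.equivocation i ≤ S.downloadCost k := by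
  have bound := S.mul_line_sub_le hN hc u k
  have decode := S.add_answerEntropy_insert_le (k := k) (s := (insert k u)ᶜ) (by simp)
  have download := S.answerEntropy_le_downloadCost k (insert k u)ᶜ
  rw [Finset.insert_compl_insert hk] at decode
  rw [Finset.sum_insert hk]
  linarith

end Scheme

theorem line_le_of_achievable {N K : ℕ} (hN : 0 < N) {r d : ℝ} (hr : 0 ≤ r)
    (h : Achievable N K r d) {u : Finset (Fin K)} {k : Fin K} (hk : k ∉ u) :
    line N u.card r ≤ d := by
  obtain ⟨L, S, hL, equivocation_lim, download_lim⟩ := h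
  have loss_lim : Tendsto (fun m => line N u.card r -
      ∑ i ∈ insert k u, (S m).equivocation i / (L m : ℝ)) atTop (𝓝 (line N u.card r)) := by
    simpa using tendsto_const_nhds.sub (tendsto_finsetSum (insert k u)
      fun i _ => equivocation_lim i)
  refine le_of_tendsto_of_tendsto loss_lim (download_lim k) ?_
  filter_upwards [hL.eventually_gt_atTop 0] with m hm
  have hLm : (0 : ℝ) < L m := by exact_mod_cast hm
  rw [← Finset.sum_div, le_div_iff₀ hLm, sub_mul, div_mul_cancel₀ _ hLm.ne', mul_comm (line _ _ _)]
  exact (S m).mul_line_sub_le_downloadCost hN (Nat.floor_le (by positivity)) hk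

theorem innerBound_le_optimalCost {N K : ℕ} (hN : 0 < N) (hK : 1 ≤ K) {r : ℝ} (hr : 0 ≤ r) :
    (innerBound N K hK r : EReal) ≤ optimalCost N K r := by
  refine le_sInf ?_
  rintro _ ⟨d, hd, rfl⟩
  refine EReal.coe_le_coe_iff.2 (Finset.sup'_le _ _ fun i hi => ?_)
  obtain ⟨hi, hiK⟩ := Finset.mem_Icc.1 hi
  let k : Fin K := ⟨K + 1 - i, by lia⟩
  rw [innerLine_eq_line N hiK]
  simpa using line_le_of_achievable hN hr hd (u := Finset.Iio k) (k := k) (by simp)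

end CachePIR

end

theorem theorem2 (N K : ℕ) (hN : 1 ≤ N) (hK : 1 ≤ K) :
    -- the lower bound on the optimal normalized download cost
    (∀ r : ℝ, 0 ≤ r → r ≤ 1 →
      (CachePIR.innerBound N K hK r : EReal) ≤ CachePIR.optimalCost N K r) ∧
    -- the bound is linear on each of `K` consecutive segments that partition `[0, 1]`
    CachePIR.corner N K 0 = 0 ∧ CachePIR.corner N K K = 1 ∧
    (∀ s : ℕ, s < K → CachePIR.corner N K s < CachePIR.corner N K (s + 1) ∧
      ∀ r : ℝ, CachePIR.corner N K s ≤ r → r ≤ CachePIR.corner N K (s + 1) →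
        CachePIR.innerBound N K hK r = CachePIR.innerLine N K (s + 2) r) ∧
    -- the slopes of consecutive segments differ: the descent gets strictly less steep
    (∀ s : ℕ, s + 1 < K →
      CachePIR.innerLine N K (s + 2) 1 - CachePIR.innerLine N K (s + 2) 0 <
        CachePIR.innerLine N K (s + 3) 1 - CachePIR.innerLine N K (s + 3) 0) := by
  refine ⟨fun r hr _ => CachePIR.innerBound_le_optimalCost hN hK hr, if_pos rfl,
    CachePIR.corner_self N (Nat.one_le_iff_ne_zero.1 hK), fun s hs => ⟨?_, fun r hr hr' => ?_⟩,
    fun s hs => CachePIR.innerLine_slope_lt hN hs⟩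
  · exact CachePIR.corner_lt_corner_succ hN hs
  · exact CachePIR.innerBound_eq_innerLine hN hK hs hr hr'
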